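/- An association scheme of rank $d+1$ on a finite set $X$ is a partition of $X\times X$ into nonempty symmetric relations $R_0,\dots,R_d$, where $R_0$ is the diagonal, together with numbers $p^h_{ij}$ such that for every $(x,y)\in R_h$ exactly $p^h_{ij}$ elements $z$ satisfy $(x,z)\in R_i$ and $(z,y)\in R_j$. For $s\neq 0$, the scheme graph of $R_s$ is the graph on $X$ whose adjacency relation is $R_s$. Its relation-distribution diagram has a bubble for each relation $R_i$ (with the bubble of $R_0$ distinguished), containing the valency $k_i=p^0_{ii}$, and the number $p^i_{sj}$ is attached at bubble $i$ to the edge from $i$ to $j$ (there is no edge if the number is $0$). The Coxeter graph is the distance-regular graph with intersection array $\{3,2,2,1;1,1,1,2\}$ (unique up to isomorphism). Splitting its distance-3 relation (of valency 12) in two gives one of the following two diagrams, with bubbles $0,1,2,3,3',4$ of valencies $1,3,6,6,6,6$. In both, the nonzero numbers $m(i,j)$ attached at $i$ to the edge from $i$ to $j$ include $m(0,1)=3$; $m(1,0)=1$, $m(1,2)=2$; $m(2,1)=m(2,3)=m(2,3')=1$; $m(3,2)=m(3,4)=1$; $m(3',2)=m(3',4)=1$; $m(4,3)=m(4,3')=m(4,4)=1$.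 The remaining nonzero numbers are - diagram $D$: $m(3,3)=m(3',3')=1$; - diagram $D'$: $m(3,3')=m(3',3)=1$. The bipartite double of a diagram has bubbles $(i,\varepsilon)$, $\varepsilon\in\{+,-\}$, with the valency of $i$ in bubble $(i,\varepsilon)$, distinguished bubble $(0,+)$, the number $m(i,j)$ attached at $(i,\varepsilon)$ to the edge from $(i,\varepsilon)$ to $(j,-\varepsilon)$ whenever $m(i,j)\neq0$, and no edges between bubbles with equal signs. (The bipartite doubles of $D$ and $D'$ are isomorphic diagrams, with 12 bubbles.) **Proposition.** 1. There is no association scheme with a scheme graph having relation-distribution diagram $D$ or $D'$. 2. There is no association scheme with a scheme graph whose relation-distribution diagram is the bipartite double of $D$ or of $D'$. 3. The distance-3 relation of the Coxeter graph cannot be split: if the Coxeter graph is a scheme graph in an association scheme, then the set of all pairs of vertices at distance 3 in that graph is a single relation of the scheme. -/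

import Mathlib

/-- A (symmetric) association scheme of rank `d + 1` on a finite set `X`: a partition of `X × X`
into nonempty symmetric relations `rel 0, …, rel d`, where `rel 0` is the diagonal, with
intersection numbers `interNum h i j` (usually written `p^h_{ij}`). -/
structure AssociationScheme (X : Type*) [Finite X] (d : ℕ) where
  rel : Fin (d + 1) → Set (X × X)
  rel_nonempty : ∀ i, (rel i).Nonempty
  existsUnique_rel : ∀ p : X × X, ∃! i, p ∈ rel i
  rel_zero : rel 0 = Set.diagonal X
  rel_symm : ∀ i x y, (x, y) ∈ rel i → (y, x) ∈ rel i
  interNum : Fin (d + 1) → Fin (d + 1) → Fin (d + 1) → ℕ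
  ncard_eq_interNum : ∀ h i j x y, (x, y) ∈ rel h →
    {z | (x, z) ∈ rel i ∧ (z, y) ∈ rel j}.ncard = interNum h i j

/-- The data shown in a relation-distribution diagram whose bubbles are indexed by `ι`: the bubble
`root` of the diagonal relation, the valency written in each bubble, and the number
`mult i j = p^i_{1j}` written next to bubble `i` on the edge from `i` to `j` (it is zero if there
is no such edge; `mult i i` is the number of the loop at `i`). -/
structure RelationDiagram (ι : Type*) where
  root : ι
  valency : ι → ℕ
  mult : ι → ι → ℕ

/-- The diagram of the bipartite double, i.e. of the direct product with the scheme of rank two on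
two points: the bubble `(i, a)` belongs to the relation with matrix `A_i ⊗ I` (for `a = false`) or
`A_i ⊗ (J - I)` (for `a = true`), and the scheme graph has matrix `A_1 ⊗ (J - I)`. -/
def RelationDiagram.bipartiteDouble {ι : Type*} (D : RelationDiagram ι) :
    RelationDiagram (ι × Bool) where
  root := (D.root, false)
  valency i := D.valency i.1
  mult i j := if i.2 = j.2 then 0 else D.mult i.1 j.1

namespace AssociationScheme

variable {X : Type*} [Finite X] {d : ℕ}

/-- The valency `k_i = p^0_{ii}`. -/
def valency (S : AssociationScheme X d) (i : Fin (d + 1)) : ℕ := S.interNum 0 i i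

/-- The scheme graph of a relation other than the diagonal. -/
def schemeGraph (S : AssociationScheme X d) (s : Fin (d + 1)) (hs : s ≠ 0) : SimpleGraph X where
  Adj x y := (x, y) ∈ S.rel s
  symm := ⟨fun x y h => S.rel_symm s x y h⟩
  loopless := ⟨fun x h => hs ((S.existsUnique_rel (x, x)).unique h
    (by rw [S.rel_zero]; exact Set.mem_diagonal x))⟩

/-- The scheme graph of `S.rel s` has the relation-distribution diagram `D`: the bubbles of `D`
correspond to the relations of `S` in such a way that all numbers agree. -/
def HasDiagram (S : AssociationScheme X d) (s : Fin (d + 1)) {ι : Type*}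
    (D : RelationDiagram ι) : Prop :=
  ∃ σ : ι ≃ Fin (d + 1), σ D.root = 0 ∧ (∀ i, S.valency (σ i) = D.valency i) ∧
    ∀ i j, S.interNum (σ i) s (σ j) = D.mult i j

end AssociationScheme

/-- `G` is a distance-regular graph of diameter `D` with intersection array
`{b 0, …, b (D - 1); c 0, …, c (D - 1)}`; so `c i` is the number usually called `c_{i+1}`. -/
def IsDistanceRegularWithArray {X : Type*} (G : SimpleGraph X) {D : ℕ} (b c : Fin D → ℕ) : Prop :=
  G.Connected ∧ G.diam = D ∧
    (∀ x y, ∀ i : Fin D, G.dist x y = i →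
      {z | G.Adj y z ∧ G.dist x z = i + 1}.ncard = b i) ∧
    (∀ x y, ∀ i : Fin D, G.dist x y = i + 1 →
      {z | G.Adj y z ∧ G.dist x z = i}.ncard = c i)

/-- The Coxeter graph: the distance-regular graph with intersection array `{3,2,2,1;1,1,1,2}`
(which is unique up to isomorphism). -/
def IsCoxeterGraph {X : Type*} (G : SimpleGraph X) : Prop :=
  IsDistanceRegularWithArray G ![3, 2, 2, 1] ![1, 1, 1, 2]

/-- A diagram of a scheme obtained from that of the Coxeter graph by splitting the distance-3
relation into two relations (bubbles 3 and 4) of valency 6; bubble 5 is the distance-4 relation.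
Here the edges of the Coxeter graph within the distance-3 vertices join vertices of the same
relation. -/
def coxeterFissionLoop : RelationDiagram (Fin 6) where
  root := 0
  valency := ![1, 3, 6, 6, 6, 6]
  mult := ![![0, 3, 0, 0, 0, 0],
            ![1, 0, 2, 0, 0, 0],
            ![0, 1, 0, 1, 1, 0],
            ![0, 0, 1, 1, 0, 1],
            ![0, 0, 1, 0, 1, 1],
            ![0, 0, 0, 1, 1, 1]]

/-- As `coxeterFissionLoop`, but the edges of the Coxeter graph within the distance-3 vertices
join vertices of different relations. -/
def coxeterFissionCross : RelationDiagram (Fin 6) where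
  root := 0
  valency := ![1, 3, 6, 6, 6, 6]
  mult := ![![0, 3, 0, 0, 0, 0],
            ![1, 0, 2, 0, 0, 0],
            ![0, 1, 0, 1, 1, 0],
            ![0, 0, 1, 0, 1, 1],
            ![0, 0, 1, 1, 0, 1],
            ![0, 0, 0, 1, 1, 1]]

/-! Let `A`, `B`, `T`, `W` be the matrices of distances 1 to 4, and suppose `T = U + V` with `U`,
`V` of equal valency. The four rules in `CoxeterRules` carry everything, so the Coxeter graph is
never constructed.

If edges inside the distance-3 set join vertices of different parts, take a heptagon. Each vertex
has two opposite vertices; they are adjacent and at distance 3 from it, so one pair lies in `U` and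
the other in `V`. The seven opposite pairs form a 7-cycle, which would be properly 2-coloured
(`CoxeterRules.false_of_cross`).

If these edges stay inside the parts, `v = U - V` satisfies `A * v = v` or `A * (A * v) = 3 • v`.
Since `B`, `T`, `2 * W` are polynomials in `A`, twice the all-ones matrix is a quartic in `A`, with
value -4 at 1 and at ±√3. Hence the all-ones matrix sends `v` to `-2v`; equal valencies say it sends
`v` to 0, so `U = V`.

For a bipartite double, the valency-one relation is an involution `N`. Multiplication by `N`
recovers the Coxeter rules on one half, and the two cases above arise according to whether `N`
preserves or exchanges the parts. For an arbitrary scheme on the Coxeter graph, integrality, double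
counting and parity reduce any splitting of distance 3 to these cases. -/

/-- A positive entry of a product of integer matrices from a pair of positive entries. -/
theorem Matrix.mul_apply_pos {X : Type*} [Fintype X] {M N : Matrix X X ℤ}
    (hM : ∀ x y, 0 ≤ M x y) (hN : ∀ x y, 0 ≤ N x y) {x y z : X}
    (h₁ : 0 < M x z) (h₂ : 0 < N z y) : 0 < (M * N) x y := by
  rw [Matrix.mul_apply]
  exact Finset.sum_pos' (fun i _ => mul_nonneg (hM _ _) (hN _ _))
    ⟨z, Finset.mem_univ _, mul_pos h₁ h₂⟩

theorem Matrix.exists_of_mul_apply_pos {X : Type*} [Fintype X] {M N : Matrix X X ℤ}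
    (hM : ∀ x y, 0 ≤ M x y) (hN : ∀ x y, 0 ≤ N x y) {x y : X}
    (h : 0 < (M * N) x y) : ∃ z, 0 < M x z ∧ 0 < N z y := by
  rw [Matrix.mul_apply] at h
  obtain ⟨z, -, hz⟩ := Finset.exists_lt_of_sum_lt (s := Finset.univ) (f := fun _ : X => (0 : ℤ))
    (g := fun z => M x z * N z y) (by simpa using h)
  refine ⟨z, lt_of_le_of_ne (hM _ _) ?_, lt_of_le_of_ne (hN _ _) ?_⟩ <;>
    · intro h0
      simp [← h0] at hz

/-! ### Algebra and heptagons of the Coxeter graph -/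

/-- The multiplication rules of the adjacency matrix `A` of the Coxeter graph with the matrices
`B`, `T`, `W` of the relations of distance 2, 3, 4. -/
structure CoxeterRules {X : Type*} [Fintype X] [DecidableEq X] (A B T W : Matrix X X ℤ) :
    Prop where
  mul_one' : A * A = 3 + B
  mul_two : A * B = 2 * A + T
  mul_three : A * T = 2 * B + T + 2 * W
  mul_four : A * W = T + W

namespace CoxeterRules

variable {X : Type*} [Fintype X] [DecidableEq X] {A B T W : Matrix X X ℤ}

/-- The first three rules give `B`, `T` and `2 * W` as polynomials in `A`; the factor 2 avoids
halving. The quartic is `(x - 2)(x + 1)(x² + 2x - 1)`, whose roots are the eigenvalues of the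
Coxeter graph other than 3. -/
theorem quartic (h : CoxeterRules A B T W) (v : Matrix X X ℤ) :
    A * (A * (A * (A * v))) + A * (A * (A * v)) - 5 • (A * (A * v)) - 3 • (A * v) + 2 • v =
      2 • ((1 + A + B + T + W) * v) := by
  have hB : B = A * A - 3 := by rw [h.mul_one']; abel
  have hT : T = A * B - 2 * A := by rw [h.mul_two]; abel
  have hW : 2 * W = A * T - 2 * B - T := by rw [h.mul_three]; abel
  have : 2 • ((1 + A + B + T + W) * v) = (2 * (1 + A + B + T) + 2 * W) * v := by
    rw [← mul_add, mul_assoc, two_mul, two_nsmul]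
  rw [this, hW, hT, hB]
  noncomm_ring

/-- `1` is not an eigenvalue of the Coxeter graph. -/
theorem mul_of_mul_eq (h : CoxeterRules A B T W) {v : Matrix X X ℤ} (hv : A * v = v) :
    (1 + A + B + T + W) * v = -(2 • v) := by
  have := h.quartic v
  simp only [hv] at this
  ext x y
  have h2 := congrFun (congrFun this x) y
  simp only [Matrix.add_apply, Matrix.sub_apply, Matrix.smul_apply, Matrix.neg_apply] at h2 ⊢
  simp only [nsmul_eq_mul] at h2 ⊢
  push_cast at h2 ⊢
  linarith

/-- `±√3` is not an eigenvalue of the Coxeter graph. -/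
theorem mul_of_mul_mul_eq (h : CoxeterRules A B T W) {v : Matrix X X ℤ}
    (hv : A * (A * v) = 3 • v) : (1 + A + B + T + W) * v = -(2 • v) := by
  have := h.quartic v
  simp only [hv, Matrix.mul_smul] at this
  ext x y
  have h2 := congrFun (congrFun this x) y
  simp only [Matrix.add_apply, Matrix.sub_apply, Matrix.smul_apply, Matrix.neg_apply] at h2 ⊢
  simp only [nsmul_eq_mul] at h2 ⊢
  push_cast at h2 ⊢
  linarith

/-- The distance-3 relation of a graph with the multiplication rules of the Coxeter graph has no
splitting that separates adjacent vertices at distance 3 from a given vertex: opposite vertices in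
a heptagon of the graph would give a proper 2-colouring of a 7-cycle. -/
theorem false_of_cross {U V : Matrix X X ℤ} (h : CoxeterRules A B T W)
    (hT : T = U + V) (hA0 : ∀ x y, 0 ≤ A x y) (hB0 : ∀ x y, 0 ≤ B x y)
    (hU0 : ∀ x y, 0 ≤ U x y) (hV0 : ∀ x y, 0 ≤ V x y) (hW0 : ∀ x y, 0 ≤ W x y)
    (hle : ∀ x y, ((1 : Matrix X X ℤ) + A + B + T) x y ≤ 1)
    (hAs : ∀ x y, A x y = A y x)
    (hUs : ∀ x y, U x y = U y x) (hVs : ∀ x y, V x y = V y x)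
    (hUU : ∀ x y z, 0 < U x y → 0 < U x z → A y z = 0)
    (hVV : ∀ x y z, 0 < V x y → 0 < V x z → A y z = 0)
    (hne : ∃ x y, 0 < T x y) : False := by
  have hT0 : ∀ x y, 0 ≤ T x y := fun x y => by
    rw [hT]; exact add_nonneg (hU0 x y) (hV0 x y)
  have hTs : ∀ x y, T x y = T y x := fun x y => by simp [hT, hUs x y, hVs x y]
  have h10 : ∀ x y, 0 ≤ (1 : Matrix X X ℤ) x y := fun x y => by
    rw [Matrix.one_apply]; split_ifs <;> norm_num
  have hle' : ∀ x y, (1 : Matrix X X ℤ) x y + A x y + B x y + T x y ≤ 1 := hle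
  have e3 : (3 : Matrix X X ℤ) = 1 + 1 + 1 := by norm_num
  have eAA : ∀ x y, (A * A) x y = 3 * (1 : Matrix X X ℤ) x y + B x y := fun x y => by
    rw [h.mul_one', e3]; simp only [Matrix.add_apply]; ring
  have eAB : ∀ x y, (A * B) x y = 2 * A x y + T x y := fun x y => by
    rw [h.mul_two, two_mul]; simp only [Matrix.add_apply]; ring
  have eAT : ∀ x y, (A * T) x y = 2 * B x y + T x y + 2 * W x y := fun x y => by
    rw [h.mul_three, two_mul, two_mul]; simp only [Matrix.add_apply]; ring
  have nAA : ∀ x, A x x = 0 := fun x => by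
    have := hle' x x
    have := hA0 x x; have := hB0 x x; have := hT0 x x
    rw [Matrix.one_apply_eq] at *
    omega
  have two : ∀ {x y z}, 0 < A x y → 0 < A y z → x ≠ z → 0 < B x z := by
    intro x y z h1 h2 hxz
    have := Matrix.mul_apply_pos hA0 hA0 h1 h2
    rw [eAA, Matrix.one_apply_ne hxz] at this
    omega
  -- There are no quadrangles: off the diagonal, `A * A` is `B`, with entries at most 1.
  have uniq : ∀ {x y y' z}, 0 < A x y → 0 < A y z → 0 < A x y' → 0 < A y' z → x ≠ z → y = y' := by
    intro x y y' z h1 h2 h3 h4 hxz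
    by_contra hyy
    have e := eAA x z
    rw [Matrix.one_apply_ne hxz, Matrix.mul_apply] at e
    have h5 : ∑ w ∈ {y, y'}, A x w * A w z ≤ ∑ w, A x w * A w z :=
      Finset.sum_le_sum_of_subset_of_nonneg (Finset.subset_univ _)
        fun i _ _ => mul_nonneg (hA0 _ _) (hA0 _ _)
    rw [Finset.sum_pair hyy] at h5
    have := mul_pos h1 h2
    have := mul_pos h3 h4
    have := hle' x z
    have := hA0 x z; have := hT0 x z
    rw [Matrix.one_apply_ne hxz] at *
    omega
  -- A non-backtracking 3-walk ends at distance 3, since an edge between its ends would close a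
  -- quadrangle.
  have three : ∀ {x y z w}, 0 < A x y → 0 < A y z → 0 < A z w → x ≠ z → y ≠ w → 0 < T x w := by
    intro x y z w h1 h2 h3 hxz hyw
    have hB := two h2 h3 hyw
    have h4 := Matrix.mul_apply_pos hA0 hB0 h1 hB
    rw [eAB] at h4
    rcases (hA0 x w).eq_or_lt with h5 | h5
    · omega
    · exact absurd (uniq h1 h2 h5 (by rwa [hAs]) hxz) hyw
  have cross : ∀ {x y z}, 0 < T x y → 0 < T x z → 0 < A y z → (0 < U x y ↔ ¬ 0 < U x z) := by
    intro x y z h1 h2 h3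
    rw [hT, Matrix.add_apply] at h1 h2
    constructor
    · intro h4 h5
      have := hUU _ _ _ h4 h5
      omega
    · intro h4
      by_contra h5
      have := hVV x y z (by omega) (by omega)
      omega
  have path : ∀ {x w}, 0 < T x w → ∃ y z, 0 < A x y ∧ 0 < A y z ∧ 0 < A z w ∧ x ≠ z ∧ y ≠ w := by
    intro x w hxw
    obtain ⟨y, h1, h2⟩ := Matrix.exists_of_mul_apply_pos hA0 hB0 (x := x) (y := w) (by
      rw [eAB]; have := hA0 x w; omega)
    have hyw : y ≠ w := by
      rintro rfl
      have := hle' x y; have := h10 x y; have := hB0 x y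
      omega
    obtain ⟨z, h3, h4⟩ := Matrix.exists_of_mul_apply_pos hA0 hA0 (x := y) (y := w) (by
      rw [eAA]; have := h10 y w; omega)
    refine ⟨y, z, h1, h3, h4, ?_, hyw⟩
    rintro rfl
    have := hle' x w; have := h10 x w; have := hB0 x w
    omega
  have ne2 : ∀ {x y z}, 0 < T x z → 0 < A y z → x ≠ y := by
    rintro x y z h1 h2 rfl
    have := hle' x z; have := h10 x z; have := hB0 x z
    omega
  have sA : ∀ {x y}, 0 < A x y → 0 < A y x := fun h => by rwa [hAs]
  have sT : ∀ {x y}, 0 < T x y → 0 < T y x := fun h => by rwa [hTs]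
  have neA : ∀ {x y}, 0 < A x y → x ≠ y := by
    rintro x y h1 rfl
    rw [nAA] at h1
    exact lt_irrefl _ h1
  have tri : ∀ {x y z}, 0 < A x y → 0 < A y z → 0 < A x z → False := by
    intro x y z h1 h2 h3
    have := two h1 h2 (neA h3)
    have := hle' x z; have := h10 x z; have := hT0 x z
    omega
  obtain ⟨x3, x0, h0⟩ := hne
  -- The term `T` in `A * T` gives an edge `x3 x4` with both ends at distance 3 from `x0`; paths
  -- from `x0` to its ends close the heptagon `x0 … x6`.
  obtain ⟨x4, a34, t40⟩ := Matrix.exists_of_mul_apply_pos hA0 hT0 (x := x3) (y := x0) (by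
    rw [eAT]; have := hB0 x3 x0; have := hW0 x3 x0; omega)
  have t03 := sT h0
  obtain ⟨x1, x2, a01, a12, a23, n02, n13⟩ := path t03
  obtain ⟨x5, x6, a45, a56, a60, n46, n50⟩ := path t40
  have n24 : x2 ≠ x4 := by
    rintro rfl
    have := two a01 a12 n02
    have := hle' x0 x2; have := h10 x0 x2; have := hA0 x0 x2
    have := sT t40
    omega
  have n35 : x3 ≠ x5 := by
    rintro rfl
    have := two a56 a60 n50
    have := hle' x3 x0; have := h10 x3 x0; have := hA0 x3 x0
    omega
  have t25 : 0 < T x2 x5 := three a23 a34 a45 n24 n35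
  -- Otherwise `x2` and `x5` have a common neighbour, although they are at distance 3 by the path
  -- through `x3`, `x4`.
  have n61 : x6 ≠ x1 := by
    rintro rfl
    rcases eq_or_ne x2 x5 with rfl | h25
    · exact tri a23 a34 (sA a45)
    · have := two (sA a12) (sA a56) h25
      have := hle' x2 x5; have := h10 x2 x5; have := hA0 x2 x5
      omega
  have t14 := three a12 a23 a34 n13 n24
  have t36 := three a34 a45 a56 n35 n46
  have t51 := three a56 a60 a01 n50 n61
  have t62 := three a60 a01 a12 n61 n02
  -- Indices are modulo 7: `ci` says that the pairs `{i, i+3}` and `{i, i+4}` have different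
  -- colours. Going round the seven pairs composes seven negations.
  have c0 := cross t03 (sT t40) a34
  have c1 := cross t14 (sT t51) a45
  have c2 := cross t25 (sT t62) a56
  have c3 := cross t36 (sT t03) a60
  have c4 := cross t40 (sT t14) a01
  have c5 := cross t51 (sT t25) a12
  have c6 := cross t62 (sT t36) a23
  rw [hUs x0 x4] at c0
  rw [hUs x1 x5] at c1
  rw [hUs x2 x6] at c2
  rw [hUs x3 x0] at c3
  rw [hUs x4 x1] at c4
  rw [hUs x5 x2] at c5
  rw [hUs x6 x3] at c6
  rw [c4, c1, c5, c2, c6, c3] at c0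
  simp only [not_not] at c0
  exact iff_not_self c0

end CoxeterRules

/-! ### Matrices and intersection numbers of a scheme -/

namespace AssociationScheme

variable {X : Type*} [Fintype X] {d : ℕ} (S : AssociationScheme X d)

open Classical in
/-- The adjacency matrix of a relation of an association scheme. -/
noncomputable def mat (i : Fin (d + 1)) : Matrix X X ℤ :=
  fun x y => if (x, y) ∈ S.rel i then 1 else 0

/-- The relation containing a given pair. -/
noncomputable def relOf (x y : X) : Fin (d + 1) := (S.existsUnique_rel (x, y)).choose

theorem relOf_eq_iff {x y : X} {i : Fin (d + 1)} : S.relOf x y = i ↔ (x, y) ∈ S.rel i := by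
  have h := (S.existsUnique_rel (x, y)).choose_spec
  exact ⟨fun e => e ▸ h.1, fun e => (h.2 i e).symm⟩

theorem mat_apply (i : Fin (d + 1)) (x y : X) :
    S.mat i x y = if S.relOf x y = i then 1 else 0 := by
  by_cases h : (x, y) ∈ S.rel i
  · simp [mat, h, S.relOf_eq_iff.2 h]
  · simp [mat, h, mt S.relOf_eq_iff.1 h]

theorem relOf_comm (x y : X) : S.relOf x y = S.relOf y x :=
  S.relOf_eq_iff.2 (S.rel_symm _ _ _ (S.relOf_eq_iff.1 rfl))

theorem relOf_eq_zero_iff {x y : X} : S.relOf x y = 0 ↔ x = y := by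
  rw [relOf_eq_iff, S.rel_zero, Set.mem_diagonal_iff]

theorem exists_relOf_eq (i : Fin (d + 1)) : ∃ x y, S.relOf x y = i := by
  obtain ⟨⟨x, y⟩, h⟩ := S.rel_nonempty i
  exact ⟨x, y, S.relOf_eq_iff.2 h⟩

theorem mat_zero [DecidableEq X] : S.mat 0 = 1 := by
  ext x y
  simp [mat_apply, relOf_eq_zero_iff, Matrix.one_apply]

theorem mat_nonneg (i : Fin (d + 1)) (x y : X) : 0 ≤ S.mat i x y := by
  rw [mat_apply]; split_ifs <;> norm_num

theorem mat_comm (i : Fin (d + 1)) (x y : X) : S.mat i x y = S.mat i y x := by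
  rw [mat_apply, mat_apply, relOf_comm]

theorem mat_pos_iff {i : Fin (d + 1)} {x y : X} : 0 < S.mat i x y ↔ S.relOf x y = i := by
  rw [mat_apply]; split_ifs with h <;> simp [h]

theorem sum_mat : ∑ i, S.mat i = Matrix.of fun _ _ => 1 := by
  ext x y
  simp [Matrix.sum_apply, mat_apply]

theorem card_filter_relOf (i j : Fin (d + 1)) (x y : X) :
    (Finset.univ.filter fun z => S.relOf x z = i ∧ S.relOf z y = j).card =
      S.interNum (S.relOf x y) i j := by
  rw [← S.ncard_eq_interNum _ i j x y (S.relOf_eq_iff.1 rfl), ← Set.ncard_coe_finset]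
  congr 1
  ext z
  simp [relOf_eq_iff]

theorem mat_mul_mat_apply (i j : Fin (d + 1)) (x y : X) :
    (S.mat i * S.mat j) x y = S.interNum (S.relOf x y) i j := by
  rw [← card_filter_relOf, Matrix.mul_apply, Finset.card_filter]
  push_cast
  refine Finset.sum_congr rfl fun z _ => ?_
  rw [mat_apply, mat_apply, ite_and]
  split_ifs <;> simp

theorem mat_mul_mat (i j : Fin (d + 1)) :
    S.mat i * S.mat j = ∑ h, (S.interNum h i j : ℤ) • S.mat h := by
  ext x y
  rw [mat_mul_mat_apply, Matrix.sum_apply]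
  simp [mat_apply, -zsmul_eq_mul, Matrix.smul_apply]

theorem interNum_comm (h i j : Fin (d + 1)) : S.interNum h i j = S.interNum h j i := by
  obtain ⟨x, y, rfl⟩ := S.exists_relOf_eq h
  rw [← card_filter_relOf, S.relOf_comm x y, ← card_filter_relOf]
  congr 1
  ext z
  simp [S.relOf_comm x z, S.relOf_comm z y, and_comm]

theorem mat_mul_comm (i j : Fin (d + 1)) : S.mat i * S.mat j = S.mat j * S.mat i := by
  ext x y
  rw [mat_mul_mat_apply, mat_mul_mat_apply, interNum_comm]

theorem card_filter_relOf_eq (i : Fin (d + 1)) (x : X) :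
    (Finset.univ.filter fun y => S.relOf x y = i).card = S.valency i := by
  have := S.card_filter_relOf i i x x
  rw [S.relOf_eq_zero_iff.2 rfl] at this
  rw [valency, ← this]
  congr 1
  ext z
  simp [S.relOf_comm z x]

theorem valency_pos (i : Fin (d + 1)) : 0 < S.valency i := by
  obtain ⟨x, y, h⟩ := S.exists_relOf_eq i
  rw [← S.card_filter_relOf_eq i x]
  exact Finset.card_pos.2 ⟨y, by simp [h]⟩

theorem of_one_mul_mat (i : Fin (d + 1)) :
    (Matrix.of fun _ _ => 1) * S.mat i = (S.valency i : ℤ) • (Matrix.of fun _ _ => 1) := by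
  ext x y
  rw [← S.card_filter_relOf_eq i y, Matrix.mul_apply, Finset.card_filter]
  simp [mat_apply, S.relOf_comm _ y, -zsmul_eq_mul, Matrix.smul_apply]

/-- Double counting: with `x` fixed, both sides count pairs `(y, z)` in relation `i` with `y` an
`h`-neighbour and `z` a `j`-neighbour of `x`. -/
theorem valency_mul_interNum (h i j : Fin (d + 1)) :
    S.valency h * S.interNum h i j = S.valency j * S.interNum j i h := by
  obtain ⟨x, -, -⟩ := S.exists_relOf_eq 0
  have key : ∀ h j, S.valency h * S.interNum h i j =
      ∑ y, ∑ z, if S.relOf x y = h ∧ S.relOf x z = j ∧ S.relOf z y = i then 1 else 0 := by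
    intro h j
    rw [← S.card_filter_relOf_eq h x, Finset.card_filter, Finset.sum_mul]
    refine Finset.sum_congr rfl fun y _ => ?_
    split_ifs with e
    · rw [S.interNum_comm, ← e, ← S.card_filter_relOf, Finset.card_filter, one_mul]
      simp
    · simp [e]
  rw [key, key, Finset.sum_comm]
  refine Finset.sum_congr rfl fun y _ => Finset.sum_congr rfl fun z _ => ?_
  rw [S.relOf_comm z y]
  congr 1
  exact propext (by tauto)

/-- The graph induced by a relation on the set of `i`-neighbours of a vertex has an even number
of directed edges. -/
theorem even_valency_mul_interNum (i t : Fin (d + 1)) (ht : t ≠ 0) :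
    Even (S.valency i * S.interNum i t i) := by
  obtain ⟨x, -, -⟩ := S.exists_relOf_eq 0
  let G : SimpleGraph X :=
    { Adj := fun y z => S.relOf x y = i ∧ S.relOf x z = i ∧ S.relOf z y = t
      symm := ⟨fun y z ⟨h1, h2, h3⟩ => ⟨h2, h1, by rwa [S.relOf_comm]⟩⟩
      loopless := ⟨fun y ⟨_, _, h3⟩ => ht (by rw [← h3, S.relOf_eq_zero_iff])⟩ }
  classical
  have h := G.sum_degrees_eq_twice_card_edges
  have : S.valency i * S.interNum i t i = ∑ v, G.degree v := by
    rw [← S.card_filter_relOf_eq i x, Finset.card_filter, Finset.sum_mul]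
    refine Finset.sum_congr rfl fun y _ => ?_
    rw [← SimpleGraph.card_neighborFinset_eq_degree, SimpleGraph.neighborFinset_eq_filter]
    split_ifs with e
    · rw [one_mul, S.interNum_comm]
      have hc := S.card_filter_relOf i t x y
      rw [e] at hc
      rw [← hc]
      congr 1
      ext z
      simp [G, e]
    · simp [G, e]
  rw [this, h]
  exact even_two_mul _

end AssociationScheme

/-! ### The diagrams and their bipartite doubles -/

namespace AssociationScheme

variable {X : Type*} [Fintype X] {d : ℕ} (S : AssociationScheme X d)

theorem mat_mul_mat_eq_sum {ι : Type*} [Fintype ι] (σ : ι ≃ Fin (d + 1)) (i j : Fin (d + 1)) :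
    S.mat i * S.mat j = ∑ k, (S.interNum (σ k) i j : ℤ) • S.mat (σ k) := by
  rw [mat_mul_mat, ← σ.sum_comp]

theorem sum_mat_comp {ι : Type*} [Fintype ι] (σ : ι ≃ Fin (d + 1)) :
    ∑ k, S.mat (σ k) = Matrix.of fun _ _ => 1 := by
  rw [← sum_mat, ← σ.sum_comp]

theorem mat_ne {i j : Fin (d + 1)} (h : i ≠ j) : S.mat i ≠ S.mat j := by
  obtain ⟨x, y, rfl⟩ := S.exists_relOf_eq i
  intro e
  have := congrFun (congrFun e x) y
  simp [mat_apply, h] at this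

/-- If the distance-3 relation splits into `u` and `v`, then some vertex has two adjacent
neighbours in the same part. -/
theorem false_of_cross [DecidableEq X] {s t u v : Fin (d + 1)} {W : Matrix X X ℤ}
    (h : CoxeterRules (S.mat s) (S.mat t) (S.mat u + S.mat v) W) (hW : ∀ x y, 0 ≤ W x y)
    (hinj : [0, s, t, u, v].Nodup) (hu : S.interNum u s u = 0) (hv : S.interNum v s v = 0) :
    False := by
  have key : ∀ i, S.interNum i s i = 0 → ∀ x y z, 0 < S.mat i x y → 0 < S.mat i x z →
      S.mat s y z = 0 := by
    intro i hi x y z hy hz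
    by_contra hne
    have h1 := Matrix.mul_apply_pos (S.mat_nonneg s) (S.mat_nonneg i)
      ((S.mat_nonneg s y z).lt_of_ne' hne) (by rwa [S.mat_comm] : 0 < S.mat i z x)
    rw [S.mat_mul_mat_apply, S.relOf_comm, S.mat_pos_iff.1 hy, hi] at h1
    exact lt_irrefl _ h1
  refine h.false_of_cross rfl (S.mat_nonneg _) (S.mat_nonneg _) (S.mat_nonneg _) (S.mat_nonneg _)
    hW ?_ (S.mat_comm _) (S.mat_comm _) (S.mat_comm _) (key u hu) (key v hv) ?_
  · intro x y
    rw [← S.mat_zero]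
    simp only [Matrix.add_apply, mat_apply]
    simp only [List.nodup_cons, List.mem_cons, List.not_mem_nil, not_or, or_false] at hinj
    obtain ⟨⟨h1, h2, h3, h4⟩, ⟨h5, h6, h7⟩, ⟨h8, h9⟩, h10, -⟩ := hinj
    split_ifs <;> simp_all
  · obtain ⟨x, y, rfl⟩ := S.exists_relOf_eq u
    exact ⟨x, y, add_pos_of_pos_of_nonneg (S.mat_pos_iff.2 rfl) (S.mat_nonneg _ _ _)⟩

theorem of_one_mul_mat_sub {i j : Fin (d + 1)} (h : S.valency i = S.valency j) :
    (Matrix.of fun _ _ => 1) * (S.mat i - S.mat j) = 0 := by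
  rw [mul_sub, of_one_mul_mat, of_one_mul_mat, h, sub_self]

theorem mat_sub_eq_zero {i j : Fin (d + 1)}
    (h : (0 : Matrix X X ℤ) = -(2 • (S.mat i - S.mat j))) : i = j := by
  by_contra hij
  refine S.mat_ne hij (sub_eq_zero.1 ?_)
  ext x y
  have := congrFun (congrFun h x) y
  simp only [Matrix.zero_apply, Matrix.neg_apply, Matrix.smul_apply, nsmul_eq_mul] at this ⊢
  push_cast at this
  omega

/-- The number from the root to the bubble of `s` is the valency of `s`, which is positive, so the
only possible neighbour of the root must be that bubble. -/
theorem eq_of_hasDiagram {ι : Type*} {D : RelationDiagram ι} {s : Fin (d + 1)} (σ : ι ≃ Fin (d + 1))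
    (h0 : σ D.root = 0) (hm : ∀ i j, S.interNum (σ i) s (σ j) = D.mult i j) {j : ι}
    (hj : ∀ k, k ≠ j → D.mult D.root k = 0) : σ j = s := by
  obtain ⟨k, rfl⟩ := σ.surjective s
  by_contra hk
  have h1 := S.valency_pos (σ k)
  rw [valency, ← h0, hm, hj k (by rintro rfl; exact hk rfl)] at h1
  exact lt_irrefl _ h1

theorem mat_mul_mat_of_hasDiagram {ι : Type*} [Fintype ι] {D : RelationDiagram ι}
    {s : Fin (d + 1)} (σ : ι ≃ Fin (d + 1))
    (hm : ∀ i j, S.interNum (σ i) s (σ j) = D.mult i j) (j : ι) :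
    S.mat s * S.mat (σ j) = ∑ k, (D.mult k j : ℤ) • S.mat (σ k) := by
  rw [S.mat_mul_mat_eq_sum σ]
  simp only [hm]

theorem not_hasDiagram_loop (s : Fin (d + 1)) : ¬ S.HasDiagram s coxeterFissionLoop := by
  classical
  rintro ⟨σ, h0, hk, hm⟩
  obtain rfl : σ 1 = s := S.eq_of_hasDiagram σ h0 hm (by decide)
  have hmul := S.mat_mul_mat_of_hasDiagram σ hm
  have hsum := S.sum_mat_comp σ
  have h1 : S.mat (σ 0) = 1 := by rw [← S.mat_zero, ← h0]; rfl
  have m1 := hmul 1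
  have m2 := hmul 2
  have m3 := hmul 3
  have m4 := hmul 4
  have m5 := hmul 5
  simp [-zsmul_eq_mul, Fin.sum_univ_six, coxeterFissionLoop, h1] at m1 m2 m3 m4 m5 hsum
  have hR : CoxeterRules (S.mat (σ 1)) (S.mat (σ 2)) (S.mat (σ 3) + S.mat (σ 4))
      (S.mat (σ 5)) := by
    refine ⟨m1, by rw [m2]; abel, ?_, m5⟩
    rw [mul_add, m3, m4, two_mul, two_mul]
    abel
  have hv : S.mat (σ 1) * (S.mat (σ 3) - S.mat (σ 4)) = S.mat (σ 3) - S.mat (σ 4) := by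
    rw [mul_sub, m3, m4]
    abel
  have h := hR.mul_of_mul_eq hv
  rw [← add_assoc (1 + _ + _), hsum, S.of_one_mul_mat_sub ((hk 3).trans (hk 4).symm)] at h
  exact absurd (σ.injective (S.mat_sub_eq_zero h)) (by decide)

theorem not_hasDiagram_cross (s : Fin (d + 1)) : ¬ S.HasDiagram s coxeterFissionCross := by
  classical
  rintro ⟨σ, h0, -, hm⟩
  obtain rfl : σ 1 = s := S.eq_of_hasDiagram σ h0 hm (by decide)
  have hmul := S.mat_mul_mat_of_hasDiagram σ hm
  have h1 : S.mat (σ 0) = 1 := by rw [← S.mat_zero, ← h0]; rfl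
  have m1 := hmul 1
  have m2 := hmul 2
  have m3 := hmul 3
  have m4 := hmul 4
  have m5 := hmul 5
  simp [-zsmul_eq_mul, Fin.sum_univ_six, coxeterFissionCross, h1] at m1 m2 m3 m4 m5
  have hR : CoxeterRules (S.mat (σ 1)) (S.mat (σ 2)) (S.mat (σ 3) + S.mat (σ 4))
      (S.mat (σ 5)) := by
    refine ⟨m1, by rw [m2]; abel, ?_, m5⟩
    rw [mul_add, m3, m4, two_mul, two_mul]
    abel
  refine S.false_of_cross hR (S.mat_nonneg _) ?_ (hm 3 3) (hm 4 4)
  rw [← h0]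
  exact List.Nodup.map (l := [0, 1, 2, 3, 4]) σ.injective (by decide)

theorem mat_mul_self_of_valency_eq_one [DecidableEq X] {n : Fin (d + 1)} (hn : S.valency n = 1) :
    S.mat n * S.mat n = 1 := by
  ext x y
  have h : ∀ a b c, S.relOf a b = n → S.relOf a c = n → b = c := fun a b c hb hc => by
    rw [← S.card_filter_relOf_eq n a, Finset.card_eq_one] at hn
    obtain ⟨z, hz⟩ := hn
    have h1 : b ∈ ({z} : Finset X) := by rw [← hz]; simp [hb]
    have h2 : c ∈ ({z} : Finset X) := by rw [← hz]; simp [hc]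
    rw [Finset.mem_singleton] at h1 h2
    rw [h1, h2]
  rw [mat_mul_mat_apply, Matrix.one_apply]
  split_ifs with hxy
  · rw [S.relOf_eq_zero_iff.2 hxy]
    exact_mod_cast hn
  · rw [← card_filter_relOf, Nat.cast_eq_zero, Finset.card_eq_zero, Finset.filter_eq_empty_iff]
    rintro z - ⟨h1, h2⟩
    exact hxy (h z x y (by rwa [relOf_comm]) h2)

/-- Multiplication by `n` takes one pair of relations to the other in sum. By integrality and equal
valencies it matches them individually, since the coefficients of `p` and `p'` in the product are
nonnegative integers with sum 1. -/
theorem mat_mul_mat_eq_or {n p p' q q' : Fin (d + 1)}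
    (hq : S.valency q = S.valency p)
    (hp' : S.valency p' = S.valency p) (hqq : q ≠ q')
    (h₁ : S.mat n * (S.mat p + S.mat p') = S.mat q + S.mat q')
    (h₂ : S.mat n * (S.mat q + S.mat q') = S.mat p + S.mat p') :
    S.mat n * S.mat q = S.mat p ∨ S.mat n * S.mat q = S.mat p' := by
  have e1 : ∀ h, S.interNum h n p + S.interNum h n p' =
      (if h = q then 1 else 0) + (if h = q' then 1 else 0) := fun h => by
    obtain ⟨x, y, rfl⟩ := S.exists_relOf_eq h
    have := congrFun (congrFun h₁ x) y
    rw [mul_add, Matrix.add_apply, Matrix.add_apply, mat_mul_mat_apply, mat_mul_mat_apply,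
      mat_apply, mat_apply] at this
    exact_mod_cast this
  have e2 : ∀ h, S.interNum h n q + S.interNum h n q' =
      (if h = p then 1 else 0) + (if h = p' then 1 else 0) := fun h => by
    obtain ⟨x, y, rfl⟩ := S.exists_relOf_eq h
    have := congrFun (congrFun h₂ x) y
    rw [mul_add, Matrix.add_apply, Matrix.add_apply, mat_mul_mat_apply, mat_mul_mat_apply,
      mat_apply, mat_apply] at this
    exact_mod_cast this
  have k0 := S.valency_pos p
  have k1 : S.interNum p n q = S.interNum q n p := by
    have := S.valency_mul_interNum p n q
    rw [hq] at this
    exact Nat.eq_of_mul_eq_mul_left k0 this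
  have k2 : S.interNum p' n q = S.interNum q n p' := by
    have := S.valency_mul_interNum p' n q
    rw [hq, hp'] at this
    exact Nat.eq_of_mul_eq_mul_left k0 this
  have e1q := e1 q
  rw [if_pos rfl, if_neg hqq] at e1q
  have out : ∀ h, h ≠ p → h ≠ p' → S.interNum h n q = 0 := fun h h1 h2 => by
    have := e2 h
    rw [if_neg h1, if_neg h2] at this
    omega
  have hmat : ∀ r, (∀ h, S.interNum h n q = if h = r then 1 else 0) →
      S.mat n * S.mat q = S.mat r := fun r hr => by
    ext x y
    rw [mat_mul_mat_apply, hr, mat_apply]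
    split_ifs <;> rfl
  rcases Nat.eq_zero_or_pos (S.interNum q n p) with hz | hz
  · right
    refine hmat _ fun h => ?_
    split_ifs with hh
    · rw [hh, k2]; omega
    · by_cases hp : h = p
      · rw [hp, k1, hz]
      · exact out h hp hh
  · left
    refine hmat _ fun h => ?_
    split_ifs with hh
    · rw [hh, k1]; omega
    · by_cases hp : h = p'
      · rw [hp, k2]; omega
      · exact out h hh hp

theorem not_hasDiagram_loop_bipartiteDouble (s : Fin (d + 1)) :
    ¬ S.HasDiagram s coxeterFissionLoop.bipartiteDouble := by
  classical
  rintro ⟨σ, h0, hk, hm⟩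
  obtain rfl : σ (1, true) = s := S.eq_of_hasDiagram σ h0 hm (by decide)
  have hmul := S.mat_mul_mat_of_hasDiagram σ hm
  have hsum := S.sum_mat_comp σ
  have h1 : S.mat (σ (0, false)) = 1 := by rw [← S.mat_zero, ← h0]; rfl
  have hN := S.mat_mul_self_of_valency_eq_one (hk (0, true))
  have m0 := hmul (0, true)
  have m1 := hmul (1, true)
  have m1' := hmul (1, false)
  have m2 := hmul (2, true)
  have m2' := hmul (2, false)
  have m3 := hmul (3, true)
  have m3' := hmul (3, false)
  have m4 := hmul (4, true)
  have m4' := hmul (4, false)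
  have m5 := hmul (5, true)
  have m5' := hmul (5, false)
  simp [-zsmul_eq_mul, Fintype.sum_prod_type, Fin.sum_univ_six, coxeterFissionLoop,
    RelationDiagram.bipartiteDouble, h1]
    at m0 m1 m1' m2 m2' m3 m3' m4 m4' m5 m5' hsum
  have hcomm := S.mat_mul_comm (σ (0, true))
  -- With `N` the matrix of `(0, true)`, the relation `(1, false)` has matrix `A' * N`, where `A'`
  -- is the scheme graph. It plays the Coxeter graph; commuting `N` past `A'` and cancelling known
  -- terms finds the action of `N` bubble by bubble.
  have hA : ∀ M, S.mat (σ (1, false)) * M = S.mat (σ (1, true)) * (S.mat (σ (0, true)) * M) :=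
    fun M => by rw [← mul_assoc, m0]
  have hA' : ∀ M, S.mat (σ (1, true)) * (S.mat (σ (0, true)) * M) =
      S.mat (σ (0, true)) * (S.mat (σ (1, true)) * M) := fun M => by
    rw [← mul_assoc, ← mul_assoc, hcomm]
  have hNN : ∀ {M M'}, S.mat (σ (0, true)) * M = M' → S.mat (σ (0, true)) * M' = M := by
    rintro M M' rfl
    rw [← mul_assoc, hN, one_mul]
  have n1 : S.mat (σ (0, true)) * S.mat (σ (1, true)) = S.mat (σ (1, false)) := by
    rw [hcomm, m0]
  have n1' := hNN n1
  have n2' : S.mat (σ (0, true)) * S.mat (σ (2, false)) = S.mat (σ (2, true)) := by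
    have e := hA' (S.mat (σ (1, true)))
    rw [n1, m1, m1', mul_add, (Commute.ofNat_right (S.mat (σ (0, true))) 3).eq] at e
    exact (add_left_cancel e).symm
  have n2 := hNN n2'
  have nT' : S.mat (σ (0, true)) * (S.mat (σ (3, false)) + S.mat (σ (4, false))) =
      S.mat (σ (3, true)) + S.mat (σ (4, true)) := by
    have e := hA' (S.mat (σ (2, true)))
    rw [n2, m2, m2', add_assoc, add_assoc, mul_add, two_mul, two_mul, mul_add, n1'] at e
    exact (add_left_cancel e).symm
  have nT := hNN nT'
  have main := S.mat_mul_mat_eq_or (n := σ (0, true)) (p := σ (3, false)) (p' := σ (4, false))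
    (q := σ (3, true)) (q' := σ (4, true)) ((hk (3, true)).trans (hk (3, false)).symm)
    ((hk (4, false)).trans (hk (3, false)).symm)
    (by simp) nT' nT
  have n5' : S.mat (σ (0, true)) * S.mat (σ (5, false)) = S.mat (σ (5, true)) := by
    have e := hA' (S.mat (σ (3, true)))
    rcases main with hq | hq
    · rw [hq, m3, m3', mul_add, mul_add, n2', hNN hq] at e
      exact (add_left_cancel e).symm
    · have hp : S.mat (σ (0, true)) * S.mat (σ (3, false)) = S.mat (σ (4, true)) := by
        rw [mul_add, hNN hq, add_comm] at nT'
        exact add_left_cancel nT'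
      rw [hq, m3, m4', mul_add, mul_add, n2', hp] at e
      exact (add_left_cancel e).symm
  have hR : CoxeterRules (S.mat (σ (1, false))) (S.mat (σ (2, false)))
      (S.mat (σ (3, false)) + S.mat (σ (4, false))) (S.mat (σ (5, false))) := by
    refine ⟨?_, ?_, ?_, ?_⟩
    · rw [hA, n1', m1]
    · rw [hA, n2', m2, add_assoc]
    · rw [hA, nT', mul_add, m3, m4, two_mul, two_mul]
      abel
    · rw [hA, n5', m5]
  rcases main with hq | hq
  · have hq' : S.mat (σ (0, true)) * S.mat (σ (4, true)) = S.mat (σ (4, false)) := by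
      rw [mul_add, hq] at nT
      exact add_left_cancel nT
    have hv : S.mat (σ (1, false)) * (S.mat (σ (3, false)) - S.mat (σ (4, false))) =
        S.mat (σ (3, false)) - S.mat (σ (4, false)) := by
      rw [hA, mul_sub (S.mat (σ (0, true))), hNN hq, hNN hq', mul_sub, m3, m4]
      abel
    have h := congrArg (fun M => (1 + S.mat (σ (0, true))) * M) (hR.mul_of_mul_eq hv)
    -- The five matrices cover only half of the relations; the factor `1 + N` supplies the other
    -- half.
    have hJ : (1 + S.mat (σ (0, true))) * (1 + S.mat (σ (1, false)) + S.mat (σ (2, false)) +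
        (S.mat (σ (3, false)) + S.mat (σ (4, false))) + S.mat (σ (5, false))) =
        Matrix.of fun _ _ => 1 := by
      rw [← hsum, add_mul, one_mul, mul_add, mul_add, mul_add, mul_add, mul_one, n1', n2', nT',
        n5']
      abel
    simp only [← mul_assoc, hJ] at h
    rw [S.of_one_mul_mat_sub ((hk (3, false)).trans (hk (4, false)).symm), mul_neg, mul_smul_comm, add_mul, one_mul,
      mul_sub, hNN hq, hNN hq'] at h
    -- Of the four relations in `(1 + N) * v` only this one is nonzero here, so the entry reads `0 =
    -- -2`.
    obtain ⟨x, y, hxy⟩ := S.exists_relOf_eq (σ (3, false))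
    have := congrFun (congrFun h x) y
    simp only [Matrix.zero_apply, Matrix.neg_apply, Matrix.smul_apply, Matrix.add_apply,
      Matrix.sub_apply, mat_apply, hxy, σ.injective.eq_iff] at this
    simp at this
  · have hp : S.mat (σ (0, true)) * S.mat (σ (3, false)) = S.mat (σ (4, true)) := by
      rw [mul_add, hNN hq, add_comm] at nT'
      exact add_left_cancel nT'
    -- As `N` exchanges the parts, loops for the scheme graph become cross edges for `A' * N`.
    refine S.false_of_cross hR (S.mat_nonneg _) ?_ ?_ ?_
    · rw [← h0]
      exact List.Nodup.map (l := [(0, false), (1, false), (2, false), (3, false), (4, false)])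
        σ.injective (by decide)
    · obtain ⟨x, y, hxy⟩ := S.exists_relOf_eq (σ (3, false))
      have := S.mat_mul_mat_apply (σ (1, false)) (σ (3, false)) x y
      rw [hA, hp, m4] at this
      simpa [mat_apply, hxy] using this.symm
    · obtain ⟨x, y, hxy⟩ := S.exists_relOf_eq (σ (4, false))
      have := S.mat_mul_mat_apply (σ (1, false)) (σ (4, false)) x y
      rw [hA, hNN hq, m3] at this
      simpa [mat_apply, hxy] using this.symm

/-- Exchanging the two distance-3 bubbles in one half only turns this double into the other. -/
theorem not_hasDiagram_cross_bipartiteDouble (s : Fin (d + 1)) :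
    ¬ S.HasDiagram s coxeterFissionCross.bipartiteDouble := by
  rintro ⟨σ, h0, hk, hm⟩
  refine S.not_hasDiagram_loop_bipartiteDouble s
    ⟨(Equiv.swap (3, true) (4, true)).trans σ, h0, fun i => (hk _).trans ?_,
      fun i j => (hm _ _).trans ?_⟩
  · revert i; decide
  · revert i j; decide

end AssociationScheme

/-! ### Distances in the Coxeter graph -/

/-- The number of neighbours at distance `i` from a vertex `x` of a vertex at distance `j` from `x`
in the Coxeter graph. -/
def coxeterCount : ℕ → ℕ → ℕ
  | 0, 1 => 3
  | 1, 0 => 1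
  | 1, 2 => 2
  | 2, 1 => 1
  | 2, 3 => 2
  | 3, 2 => 1
  | 3, 3 => 1
  | 3, 4 => 1
  | 4, 3 => 2
  | 4, 4 => 1
  | _, _ => 0

namespace IsCoxeterGraph

variable {X : Type*} {G : SimpleGraph X}

theorem dist_le (h : IsCoxeterGraph G) (x y : X) : G.dist x y ≤ 4 := by
  have hd : G.diam = 4 := h.2.1
  rw [← hd]
  -- An infinite diameter would have `diam` equal to the default value 0.
  exact SimpleGraph.dist_le_diam (SimpleGraph.ediam_ne_top_of_diam_ne_zero (by rw [hd]; norm_num))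

/-- The array gives the counts one step outward and inward; the count at equal distance is what
remains of the degree 3, as distance changes by at most 1 along an edge. -/
theorem ncard_eq [Finite X] (h : IsCoxeterGraph G) (x y : X) (i : ℕ) :
    {z | G.Adj y z ∧ G.dist x z = i}.ncard = coxeterCount (G.dist x y) i := by
  have hle := h.dist_le
  obtain ⟨hc, hd, hb, hcc⟩ := h
  have hnear : ∀ z, G.Adj y z → G.dist x z = G.dist x y ∨ G.dist x z = G.dist x y + 1 ∨
      G.dist x z + 1 = G.dist x y := fun z hz => by
    have h1 := hc.dist_triangle (u := x) (v := y) (w := z)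
    have h2 := hc.dist_triangle (u := x) (v := z) (w := y)
    rw [SimpleGraph.dist_eq_one_iff_adj.2 hz] at h1
    rw [SimpleGraph.dist_eq_one_iff_adj.2 hz.symm] at h2
    omega
  have hempty : ∀ i, i ≠ G.dist x y → i ≠ G.dist x y + 1 → i + 1 ≠ G.dist x y →
      {z | G.Adj y z ∧ G.dist x z = i}.ncard = 0 := by
    intro i h1 h2 h3
    rw [Set.ncard_eq_zero, Set.eq_empty_iff_forall_notMem]
    rintro z ⟨h4, h5⟩
    have := hnear z h4
    omega
  have hdeg : {z | G.Adj y z}.ncard = 3 := by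
    rw [← show _ = 3 from hb y y 0 (by simp)]
    congr 1
    ext z
    simp
  have htot : ∑ i ∈ Finset.range 5, {z | G.Adj y z ∧ G.dist x z = i}.ncard = 3 := by
    classical
    cases nonempty_fintype X
    rw [← hdeg, Set.ncard_eq_toFinset_card', Finset.card_eq_sum_card_fiberwise
      (f := fun z => G.dist x z) (t := Finset.range 5)]
    · refine Finset.sum_congr rfl fun i _ => ?_
      rw [Set.ncard_eq_toFinset_card']
      congr 1
      ext z
      simp
    · intro z _
      have := hle x z
      simp only [Finset.coe_range, Set.mem_Iio]
      omega
  have hb0 := hb x y 0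
  have hb1 := hb x y 1
  have hb2 := hb x y 2
  have hb3 := hb x y 3
  have hc0 := hcc x y 0
  have hc1 := hcc x y 1
  have hc2 := hcc x y 2
  have hc3 := hcc x y 3
  simp only [Finset.sum_range_succ, Finset.sum_range_zero] at htot
  have hj := hle x y
  by_cases hi : i ≤ 4
  · generalize G.dist x y = j at *
    generalize hn : (fun i => {z | G.Adj y z ∧ G.dist x z = i}.ncard) = n at *
    have hn' : ∀ i, {z | G.Adj y z ∧ G.dist x z = i}.ncard = n i := fun i => by rw [← hn]
    simp only [hn'] at *
    have e0 := hempty 0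
    have e1 := hempty 1
    have e2 := hempty 2
    have e3 := hempty 3
    have e4 := hempty 4
    clear hn hn' hempty hb hcc hnear hle
    interval_cases j <;> simp at hb0 hb1 hb2 hb3 hc0 hc1 hc2 hc3 e0 e1 e2 e3 e4 <;>
      interval_cases i <;> simp only [coxeterCount] <;> omega
  · have hz : {z | G.Adj y z ∧ G.dist x z = i}.ncard = 0 := by
      rw [Set.ncard_eq_zero, Set.eq_empty_iff_forall_notMem]
      rintro z ⟨-, rfl⟩
      exact hi (hle x z)
    rw [hz]
    generalize G.dist x y = j
    unfold coxeterCount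
    split <;> first | rfl | omega

end IsCoxeterGraph

/-- The distance-`i` matrix of a graph. -/
noncomputable def SimpleGraph.distMatrix {X : Type*} (G : SimpleGraph X) (i : ℕ) : Matrix X X ℤ :=
  fun x y => if G.dist x y = i then 1 else 0

namespace IsCoxeterGraph

variable {X : Type*} [Fintype X] {G : SimpleGraph X}

theorem distMatrix_mul_apply (h : IsCoxeterGraph G) (i : ℕ) (x y : X) :
    (G.distMatrix 1 * G.distMatrix i) x y = coxeterCount (G.dist x y) i := by
  classical
  rw [G.dist_comm, ← h.ncard_eq y x i, Matrix.mul_apply, Set.ncard_eq_toFinset_card',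
    Set.toFinset_ofPred, Finset.card_filter]
  push_cast
  refine Finset.sum_congr rfl fun z _ => ?_
  simp only [SimpleGraph.distMatrix, SimpleGraph.dist_eq_one_iff_adj, G.dist_comm (u := z)]
  rw [ite_and]
  split_ifs <;> simp

theorem distMatrix_zero {X : Type*} {G : SimpleGraph X} [DecidableEq X] (h : IsCoxeterGraph G) : G.distMatrix 0 = 1 := by
  ext x y
  simp [SimpleGraph.distMatrix, h.1.dist_eq_zero_iff, Matrix.one_apply]

theorem coxeterRules [DecidableEq X] (h : IsCoxeterGraph G) :
    CoxeterRules (G.distMatrix 1) (G.distMatrix 2) (G.distMatrix 3) (G.distMatrix 4) := by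
  have e3 : (3 : Matrix X X ℤ) = G.distMatrix 0 + G.distMatrix 0 + G.distMatrix 0 := by
    rw [h.distMatrix_zero]; norm_num
  constructor
  all_goals
    ext x y
    rw [h.distMatrix_mul_apply]
    simp only [two_mul, e3, Matrix.add_apply, SimpleGraph.distMatrix]
    have := h.dist_le x y
    generalize G.dist x y = j at *
    interval_cases j <;> rfl

theorem sum_distMatrix {X : Type*} {G : SimpleGraph X} [DecidableEq X] (h : IsCoxeterGraph G) :
    1 + G.distMatrix 1 + G.distMatrix 2 + G.distMatrix 3 + G.distMatrix 4 =
      Matrix.of fun _ _ => 1 := by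
  ext x y
  rw [← h.distMatrix_zero]
  simp only [Matrix.add_apply, SimpleGraph.distMatrix, Matrix.of_apply]
  have := h.dist_le x y
  generalize G.dist x y = j at *
  interval_cases j <;> rfl

end IsCoxeterGraph

/-! ### Distance relations are unions of scheme relations -/

namespace AssociationScheme

variable {X : Type*} [Fintype X] {d : ℕ} (S : AssociationScheme X d)

/-- Matrices that are constant on the relations of the scheme. -/
def IsConst (M : Matrix X X ℤ) : Prop := ∃ f : Fin (d + 1) → ℤ, ∀ x y, M x y = f (S.relOf x y)

theorem isConst_mat (i : Fin (d + 1)) : S.IsConst (S.mat i) :=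
  ⟨fun j => if j = i then 1 else 0, S.mat_apply i⟩

variable {S}

theorem IsConst.sub {M N : Matrix X X ℤ} (hM : S.IsConst M) (hN : S.IsConst N) :
    S.IsConst (M - N) := by
  obtain ⟨f, hf⟩ := hM
  obtain ⟨g, hg⟩ := hN
  exact ⟨f - g, fun x y => by simp [hf, hg]⟩

theorem IsConst.mat_mul {M : Matrix X X ℤ} (hM : S.IsConst M) (i : Fin (d + 1)) :
    S.IsConst (S.mat i * M) := by
  obtain ⟨f, hf⟩ := hM
  refine ⟨fun h => ∑ j, f j * S.interNum h i j, fun x y => ?_⟩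
  have : M = ∑ j, f j • S.mat j := by
    ext a b
    simp [Matrix.sum_apply, mat_apply, hf, -zsmul_eq_mul, Matrix.smul_apply]
  rw [this, Matrix.mul_sum, Matrix.sum_apply]
  refine Finset.sum_congr rfl fun j _ => ?_
  rw [Matrix.mul_smul, Matrix.smul_apply, mat_mul_mat_apply, smul_eq_mul]

theorem IsConst.of_two_mul {M : Matrix X X ℤ} (hM : S.IsConst (M + M)) : S.IsConst M := by
  obtain ⟨f, hf⟩ := hM
  refine ⟨fun j => f j / 2, fun x y => ?_⟩
  have := hf x y
  rw [Matrix.add_apply] at this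
  simp only
  omega

variable (S)

theorem distMatrix_one_schemeGraph {s : Fin (d + 1)} (hs : s ≠ 0) :
    (S.schemeGraph s hs).distMatrix 1 = S.mat s := by
  ext x y
  have : (S.schemeGraph s hs).dist x y = 1 ↔ S.relOf x y = s := by
    rw [SimpleGraph.dist_eq_one_iff_adj, relOf_eq_iff]
    rfl
  simp only [SimpleGraph.distMatrix, mat_apply, this]

/-- In a scheme with the Coxeter graph as a scheme graph, the distance of a pair of vertices
depends only on the relation containing it. -/
theorem exists_dist_eq {s : Fin (d + 1)} (hs : s ≠ 0) (h : IsCoxeterGraph (S.schemeGraph s hs)) :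
    ∃ δ : Fin (d + 1) → ℕ, ∀ x y, (S.schemeGraph s hs).dist x y = δ (S.relOf x y) := by
  classical
  have hR := h.coxeterRules
  rw [S.distMatrix_one_schemeGraph] at hR
  have h0 := h.distMatrix_zero
  have h1 := S.distMatrix_one_schemeGraph hs
  have hle := h.dist_le
  have hdef : ∀ i x y, (S.schemeGraph s hs).distMatrix i x y =
    if (S.schemeGraph s hs).dist x y = i then 1 else 0 := fun _ _ _ => rfl
  generalize (S.schemeGraph s hs).distMatrix = D at *
  have c0 : S.IsConst (D 0) := by
    rw [h0, ← S.mat_zero]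
    exact S.isConst_mat 0
  have c1 := S.isConst_mat s
  have c2 : S.IsConst (D 2) := by
    have e : D 2 = S.mat s * S.mat s - D 0 - D 0 - D 0 := by
      rw [hR.mul_one', h0, show (3 : Matrix X X ℤ) = 1 + 1 + 1 by norm_num]
      abel
    rw [e]
    exact (((c1.mat_mul s).sub c0).sub c0).sub c0
  have c3 : S.IsConst (D 3) := by
    have e : D 3 = S.mat s * D 2 - S.mat s - S.mat s := by
      rw [hR.mul_two]
      noncomm_ring
    rw [e]
    exact ((c2.mat_mul s).sub c1).sub c1
  -- Only `2 * D 4` is an integral polynomial in the adjacency matrix, hence the halving.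
  have c4 : S.IsConst (D 4) := by
    refine IsConst.of_two_mul ?_
    have e : D 4 + D 4 = S.mat s * D 3 - D 2 - D 2 - D 3 := by
      rw [hR.mul_three]
      noncomm_ring
    rw [e]
    exact (((c3.mat_mul s).sub c2).sub c2).sub c3
  rw [← h1] at c1
  have key : ∀ i, i ≤ 4 → S.IsConst (D i) := by
    intro i hi
    interval_cases i <;> assumption
  have hrep : ∀ g, ∃ p : X × X, S.relOf p.1 p.2 = g := fun g => by
    obtain ⟨x, y, e⟩ := S.exists_relOf_eq g
    exact ⟨(x, y), e⟩
  choose p hp using hrep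
  refine ⟨fun g => (S.schemeGraph s hs).dist (p g).1 (p g).2, fun x y => ?_⟩
  obtain ⟨f, hf⟩ := key _ (hle x y)
  have e := hf (p (S.relOf x y)).1 (p (S.relOf x y)).2
  rw [hp, ← hf x y, hdef, hdef, if_pos rfl] at e
  by_contra hne
  rw [if_neg (Ne.symm hne)] at e
  exact zero_ne_one e

end AssociationScheme

/-! ### The distance-3 relation cannot be split -/

namespace AssociationScheme

variable {X : Type*} [Fintype X] {d : ℕ} (S : AssociationScheme X d)

/-- The numbers of neighbours of a relation add up to those of the Coxeter graph. -/
theorem sum_interNum_eq {s : Fin (d + 1)} (hs : s ≠ 0) (h : IsCoxeterGraph (S.schemeGraph s hs))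
    {δ : Fin (d + 1) → ℕ} (hδ : ∀ x y, (S.schemeGraph s hs).dist x y = δ (S.relOf x y))
    (g : Fin (d + 1)) (i : ℕ) :
    ∑ j with δ j = i, S.interNum g s j = coxeterCount (δ g) i := by
  obtain ⟨x, y, rfl⟩ := S.exists_relOf_eq g
  have e := h.distMatrix_mul_apply i x y
  have hD : (S.schemeGraph s hs).distMatrix i = ∑ j with δ j = i, S.mat j := by
    ext a b
    rw [Matrix.sum_apply]
    simp [mat_apply, SimpleGraph.distMatrix, hδ]
  rw [S.distMatrix_one_schemeGraph, hD, Matrix.mul_sum, Matrix.sum_apply, hδ] at e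
  simp only [mat_mul_mat_apply] at e
  exact_mod_cast e

/-- A splitting of the distance-3 relation of the Coxeter graph in which adjacent vertices at
distance 3 from a given vertex are in the same part. -/
theorem false_of_loop [DecidableEq X] {s t u v : Fin (d + 1)} {W : Matrix X X ℤ}
    (hR : CoxeterRules (S.mat s) (S.mat t) (S.mat u + S.mat v) W)
    (hJ : 1 + S.mat s + S.mat t + (S.mat u + S.mat v) + W = Matrix.of fun _ _ => 1)
    (huv : u ≠ v) (hk : S.valency u = S.valency v)
    (h : S.mat s * (S.mat u - S.mat v) = S.mat u - S.mat v ∨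
      S.mat s * (S.mat s * (S.mat u - S.mat v)) = 3 • (S.mat u - S.mat v)) : False := by
  have e := h.elim hR.mul_of_mul_eq hR.mul_of_mul_mul_eq
  rw [hJ, S.of_one_mul_mat_sub hk] at e
  exact huv (S.mat_sub_eq_zero e)

/-- A splitting of the distance-3 relation of the Coxeter graph in which the distance-4 relation
splits accordingly. -/
theorem mul_mul_eq_of_split {s t u v w : Fin (d + 1)} {δ : Fin (d + 1) → ℕ}
    (hs : s ≠ 0) (hδ : ∀ g, δ g ≤ 4)
    (h0 : ∀ g, δ g = 0 ↔ g = 0) (h1 : ∀ g, δ g = 1 ↔ g = s) (h2 : ∀ g, δ g = 2 ↔ g = t)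
    (h3 : ∀ g, δ g = 3 ↔ g = u ∨ g = v) (huv : u ≠ v)
    (hsum : ∀ g i, ∑ j with δ j = i, S.interNum g s j = coxeterCount (δ g) i)
    (hku : S.valency u = 6) (hkv : S.valency v = 6)
    (htu : S.interNum t s u = 1) (htv : S.interNum t s v = 1)
    (huu : S.interNum u s u = 1) (hvu : S.interNum v s u = 0)
    (huv' : S.interNum u s v = 0) (hvv : S.interNum v s v = 1)
    (hw : δ w = 4) (hwu : S.interNum w s u = 2) (hwv : S.interNum w s v = 0) :
    S.mat s * (S.mat s * (S.mat u - S.mat v)) = 3 • (S.mat u - S.mat v) := by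
  have hle : ∀ g j, S.interNum g s j ≤ coxeterCount (δ g) (δ j) := fun g j => by
    rw [← hsum]
    exact Finset.single_le_sum (f := fun j => S.interNum g s j) (fun _ _ => Nat.zero_le _)
      (by simp)
  have hle2 : ∀ g j j', j ≠ j' → δ j = δ j' →
      S.interNum g s j + S.interNum g s j' ≤ coxeterCount (δ g) (δ j) := fun g j j' hj e => by
    rw [← hsum, ← Finset.sum_pair hj]
    refine Finset.sum_le_sum_of_subset fun a ha => ?_
    rcases Finset.mem_insert.1 ha with rfl | ha
    · simp
    · rw [Finset.mem_singleton.1 ha]; simp [e]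
  have du := (h3 u).2 (Or.inl rfl)
  have dv := (h3 v).2 (Or.inr rfl)
  have ds := (h1 s).2 rfl
  have dt := (h2 t).2 rfl
  have d0 := (h0 0).2 rfl
  have hf3 : (Finset.univ.filter fun j => δ j = 3) = {u, v} := by
    ext a; simp [h3]
  have h4uv : ∀ g, δ g = 4 → S.interNum g s u + S.interNum g s v = 2 := fun g hg => by
    have := hsum g 3
    rwa [hf3, Finset.sum_pair huv, hg] at this
  have huw : S.interNum u s w = 1 ∧ S.valency w = 3 := by
    have e1 := S.valency_mul_interNum u s w
    have e2 := hle u w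
    rw [du, hw] at e2
    simp only [coxeterCount] at e2
    rw [hku, hwu] at e1
    have := S.valency_pos w
    omega
  obtain ⟨huw, hkw⟩ := huw
  have hvw : S.interNum v s w = 0 := by
    have e1 := S.valency_mul_interNum v s w
    rw [hkv, hwv] at e1
    omega
  have hother : ∀ g, δ g = 4 → g ≠ w →
      S.interNum g s u = 0 ∧ S.interNum g s v = 2 ∧ S.interNum u s g = 0 ∧
        S.interNum v s g = 1 ∧ S.valency g = 3 := by
    intro g hg hgw
    have e1 := hle2 u g w hgw (by rw [hg, hw])
    have e2 := S.valency_mul_interNum u s g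
    have e3 := S.valency_mul_interNum v s g
    have e4 := hle v g
    have e5 := h4uv g hg
    have e6 := S.valency_pos g
    rw [du, hg] at e1
    rw [dv, hg] at e4
    simp only [coxeterCount] at e1 e4
    have e7 : S.interNum u s g = 0 := by omega
    rw [e7, mul_zero] at e2
    have e8 : S.interNum g s u = 0 := by
      rcases Nat.mul_eq_zero.1 e2.symm with e | e
      · omega
      · exact e
    have e9 : S.interNum g s v = 2 := by omega
    rw [hkv, e9] at e3
    omega
  -- The valency of `w` is 3, so parity excludes a loop number 1. The distance-4 edges at `w`
  -- therefore lead to another part `h`, attached to `v`.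
  have hww : S.interNum w s w = 0 := by
    have e1 := S.even_valency_mul_interNum w s hs
    have e2 := hle w w
    rw [hw] at e2
    simp only [coxeterCount] at e2
    rw [hkw] at e1
    obtain ⟨r, hr⟩ := e1
    omega
  obtain ⟨h, hh, hwh⟩ : ∃ h, δ h = 4 ∧ S.interNum w s h ≠ 0 := by
    have e1 := hsum w 4
    rw [hw] at e1
    obtain ⟨h, e2, e3⟩ := Finset.exists_ne_zero_of_sum_ne_zero
      (show ∑ j with δ j = 4, S.interNum w s j ≠ 0 by rw [e1]; simp [coxeterCount])
    exact ⟨h, by simpa using e2, e3⟩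
  have hne : h ≠ w := by
    rintro rfl
    exact hwh hww
  obtain ⟨hhu, hhv, huh, hvh, hkh⟩ := hother h hh hne
  have hwh : S.interNum w s h = 1 := by
    have := hle w h
    rw [hw, hh] at this
    simp only [coxeterCount] at this
    omega
  have hhw : S.interNum h s w = 1 := by
    have := S.valency_mul_interNum h s w
    rw [hkh, hkw, hwh] at this
    omega
  have hhh : S.interNum h s h = 0 := by
    have := hle2 h h w hne (by rw [hh, hw])
    rw [hh] at this
    simp only [coxeterCount] at this
    omega
  have h4 : ∀ g, δ g = 4 → g = w ∨ g = h := by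
    intro g hg
    by_contra! hg'
    have := hle2 v g h hg'.2 (by rw [hg, hh])
    rw [(hother g hg hg'.1).2.2.2.1, hvh, dv, hg] at this
    simp [coxeterCount] at this
  have hcases : ∀ g, g = 0 ∨ g = s ∨ g = t ∨ g = u ∨ g = v ∨ g = w ∨ g = h := by
    intro g
    have := hδ g
    have : δ g = 0 ∨ δ g = 1 ∨ δ g = 2 ∨ δ g = 3 ∨ δ g = 4 := by omega
    rw [h0, h1, h2, h3, or_assoc] at this
    exact this.imp_right (Or.imp_right (Or.imp_right (Or.imp_right (Or.imp_right (h4 g)))))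
  have hz : ∀ g j, coxeterCount (δ g) (δ j) = 0 → S.interNum g s j = 0 := fun g j e =>
    Nat.le_zero.1 (e ▸ hle g j)
  have hnd : ∀ a b, δ a ≠ δ b → (a = b ↔ False) := fun a b e1 =>
    ⟨fun e2 => e1 (by rw [e2]), False.elim⟩
  -- The span of `u - v` and `w - h` is invariant, with matrix of trace 0 and determinant -3; this
  -- is the origin of the 3.
  have e1 : S.mat s * (S.mat u - S.mat v) =
      S.mat u - S.mat v + (S.mat w - S.mat h) + (S.mat w - S.mat h) := by
    ext x y
    rw [mul_sub]
    simp only [Matrix.add_apply, Matrix.sub_apply, mat_mul_mat_apply, mat_apply]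
    generalize S.relOf x y = g
    rcases hcases g with rfl | rfl | rfl | rfl | rfl | rfl | rfl <;>
      simp [hnd, hz, coxeterCount, d0, ds, dt, du, dv, hw, hh, htu, htv, huu, hvu, huv', hvv, hwu,
        hwv, hhu, hhv, huv, huv.symm, hne, hne.symm]
  have e2 : S.mat s * (S.mat w - S.mat h) = S.mat u - S.mat v - (S.mat w - S.mat h) := by
    ext x y
    rw [mul_sub]
    simp only [Matrix.sub_apply, mat_mul_mat_apply, mat_apply]
    generalize S.relOf x y = g
    rcases hcases g with rfl | rfl | rfl | rfl | rfl | rfl | rfl <;>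
      simp [hnd, hz, coxeterCount, d0, ds, dt, du, dv, hw, hh, huw, hvw, huh, hvh, hww, hwh, hhw,
        hhh, huv, huv.symm, hne, hne.symm]
  rw [e1, mul_add, mul_add, e1, e2]
  abel

theorem exists_rel_eq_of_isCoxeterGraph (s : Fin (d + 1)) (hs : s ≠ 0)
    (h : IsCoxeterGraph (S.schemeGraph s hs)) :
    ∃ i, S.rel i = {p | (S.schemeGraph s hs).dist p.1 p.2 = 3} := by
  classical
  obtain ⟨δ, hδ⟩ := S.exists_dist_eq hs h
  have hsum := S.sum_interNum_eq hs h hδ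
  have hδ4 : ∀ g, δ g ≤ 4 := fun g => by
    obtain ⟨x, y, rfl⟩ := S.exists_relOf_eq g
    rw [← hδ]
    exact h.dist_le x y
  have h0 : ∀ g, δ g = 0 ↔ g = 0 := fun g => by
    obtain ⟨x, y, rfl⟩ := S.exists_relOf_eq g
    rw [← hδ, h.1.dist_eq_zero_iff, relOf_eq_zero_iff]
  have h1 : ∀ g, δ g = 1 ↔ g = s := fun g => by
    obtain ⟨x, y, rfl⟩ := S.exists_relOf_eq g
    rw [← hδ, SimpleGraph.dist_eq_one_iff_adj, relOf_eq_iff]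
    rfl
  have ds := (h1 s).2 rfl
  have d0 := (h0 0).2 rfl
  have hle : ∀ g j, S.interNum g s j ≤ coxeterCount (δ g) (δ j) := fun g j => by
    rw [← hsum]
    exact Finset.single_le_sum (f := fun j => S.interNum g s j) (fun _ _ => Nat.zero_le _)
      (by simp)
  have hle2 : ∀ g j j', j ≠ j' → δ j = δ j' →
      S.interNum g s j + S.interNum g s j' ≤ coxeterCount (δ g) (δ j) := fun g j j' hj e => by
    rw [← hsum, ← Finset.sum_pair hj]
    refine Finset.sum_le_sum_of_subset fun a ha => ?_
    rcases Finset.mem_insert.1 ha with rfl | ha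
    · simp
    · rw [Finset.mem_singleton.1 ha]; simp [e]
  have hsingle : ∀ {i j}, (∀ g, δ g = i ↔ g = j) → ∀ g, S.interNum g s j = coxeterCount (δ g) i :=
    fun {i j} hj g => by
      rw [← hsum, show (Finset.univ.filter fun g => δ g = i) = {j} by ext a; simp [hj],
        Finset.sum_singleton]
  have hex : ∀ g i, coxeterCount (δ g) i ≠ 0 → ∃ j, δ j = i := fun g i hg => by
    rw [← hsum] at hg
    obtain ⟨j, e, -⟩ := Finset.exists_ne_zero_of_sum_ne_zero hg
    exact ⟨j, by simpa using e⟩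
  have hks : S.valency s = 3 := by
    have := hsingle h1 0
    rwa [d0] at this
  obtain ⟨t, dt⟩ := hex s 2 (by rw [ds]; simp [coxeterCount])
  -- On the three neighbours of a vertex, relation `j` is a regular graph, so its degree is even.
  -- These degrees sum to 2, hence distance 2 does not split.
  have hst : ∀ j, δ j = 2 → S.valency j = 3 * S.interNum s s j ∧ 2 ≤ S.interNum s s j := by
    intro j hj
    have e1 := S.valency_mul_interNum s s j
    rw [hsingle h1 j, hj, hks] at e1
    simp only [coxeterCount] at e1
    have e2 := S.valency_pos j
    have e3 := S.even_valency_mul_interNum s j (by rw [Ne, ← h0, hj]; norm_num)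
    rw [hks, S.interNum_comm] at e3
    obtain ⟨r, hr⟩ := e3
    omega
  have h2 : ∀ g, δ g = 2 ↔ g = t := by
    refine fun g => ⟨fun hg => ?_, fun hg => by rw [hg, dt]⟩
    by_contra hne
    have e := hle2 s g t hne (by rw [hg, dt])
    have e1 := hst g hg
    have e2 := hst t dt
    rw [ds, hg] at e
    simp only [coxeterCount] at e
    omega
  have hkt : S.valency t = 6 := by
    rw [(hst t dt).1, hsingle h2 s, ds]
    rfl
  obtain ⟨u, du⟩ := hex t 3 (by rw [dt]; simp [coxeterCount])
  refine ⟨u, ?_⟩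
  suffices h3 : ∀ g, δ g = 3 → g = u by
    ext ⟨x, y⟩
    rw [← relOf_eq_iff, Set.mem_ofPred_eq, hδ]
    exact ⟨fun e => by rw [e, du], h3 _⟩
  by_contra! hv
  obtain ⟨v, dv, hvu⟩ := hv
  -- A vertex at distance 3 has one neighbour at distance 2. The numbers `S.interNum t s j` sum to
  -- 2, so a proper splitting has exactly two parts, of valency 6.
  have hk3 : ∀ j, δ j = 3 → S.valency j = 6 * S.interNum t s j ∧ 1 ≤ S.interNum t s j := by
    intro j hj
    have e1 := S.valency_mul_interNum t s j
    rw [hsingle h2 j, hj, hkt] at e1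
    simp only [coxeterCount] at e1
    have e2 := S.valency_pos j
    omega
  have etuv := hle2 t v u hvu (by rw [du, dv])
  rw [dt, dv] at etuv
  simp only [coxeterCount] at etuv
  obtain ⟨hku, htu⟩ := hk3 u du
  obtain ⟨hkv, htv⟩ := hk3 v dv
  have htu : S.interNum t s u = 1 := by omega
  have htv : S.interNum t s v = 1 := by omega
  rw [htu] at hku
  rw [htv] at hkv
  have hf3 : ∀ g, δ g = 3 ↔ g = u ∨ g = v := by
    refine fun g => ⟨fun hg => ?_, ?_⟩
    · by_contra! hne
      have e1 := hsum t 3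
      have e2 : ∑ j ∈ {g, u, v}, S.interNum t s j ≤ ∑ j with δ j = 3, S.interNum t s j := by
        refine Finset.sum_le_sum_of_subset fun a ha => ?_
        simp only [Finset.mem_insert, Finset.mem_singleton] at ha
        rcases ha with rfl | rfl | rfl <;> simp [*]
      rw [Finset.sum_insert (by simp [hne.1, hne.2]), Finset.sum_pair hvu.symm, e1, dt, htu,
        htv] at e2
      simp only [coxeterCount] at e2
      have := (hk3 g hg).2
      omega
    · rintro (rfl | rfl) <;> assumption
  have hF : (Finset.univ.filter fun j => δ j = 3) = {u, v} := by
    ext a; simp [hf3]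
  have hrow : ∀ g, S.interNum g s u + S.interNum g s v = coxeterCount (δ g) 3 := fun g => by
    rw [← hsum, hF, Finset.sum_pair hvu.symm]
  have hmat : ∀ i j, (∀ g, δ g = i ↔ g = j) →
      (S.schemeGraph s hs).distMatrix i = S.mat j := fun i j hj => by
    ext x y
    simp only [SimpleGraph.distMatrix, mat_apply, hδ, hj]
  have hmat3 : (S.schemeGraph s hs).distMatrix 3 = S.mat u + S.mat v := by
    ext x y
    simp only [SimpleGraph.distMatrix, Matrix.add_apply, mat_apply, hδ, hf3]
    generalize S.relOf x y = g
    by_cases e : g = u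
    · simp [e, hvu.symm]
    · simp [e]
  have hR := h.coxeterRules
  have hJ := h.sum_distMatrix
  rw [hmat3, hmat 1 s h1, hmat 2 t h2] at hR hJ
  have hW0 : ∀ x y, 0 ≤ (S.schemeGraph s hs).distMatrix 4 x y := fun x y => by
    simp only [SimpleGraph.distMatrix]
    split_ifs <;> norm_num
  have eu := hrow u
  have ev := hrow v
  have euv := S.valency_mul_interNum u s v
  rw [hku, hkv] at euv
  rw [du] at eu
  rw [dv] at ev
  simp only [coxeterCount] at eu ev
  rcases Nat.eq_zero_or_pos (S.interNum u s u) with hc | hc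
  · have ne : ∀ {a b}, δ a ≠ δ b → a ≠ b := fun e1 e2 => e1 (by rw [e2])
    refine S.false_of_cross hR hW0 ?_ hc (by omega)
    simp only [List.nodup_cons, List.mem_cons, List.not_mem_nil, not_or, or_false]
    refine ⟨⟨?_, ?_, ?_, ?_⟩, ⟨?_, ?_, ?_⟩, ⟨?_, ?_⟩, hvu.symm, not_false, List.nodup_nil⟩ <;>
      exact ne (by omega)
  · refine S.false_of_loop hR hJ hvu.symm (by rw [hku, hkv]) ?_
    -- Each distance-4 vertex has two neighbours at distance 3. If they are always shared equally,
    -- `u - v` has eigenvalue 1; otherwise some relation sends both to one part, and distance 4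
    -- splits too.
    by_cases hall : ∀ g, δ g = 4 → S.interNum g s u = S.interNum g s v
    · left
      ext x y
      rw [mul_sub]
      simp only [Matrix.sub_apply, mat_mul_mat_apply, mat_apply]
      generalize S.relOf x y = g
      by_cases hgu : g = u
      · rw [if_pos hgu, if_neg (hgu ▸ hvu.symm), hgu]
        omega
      by_cases hgv : g = v
      · rw [if_neg hgu, if_pos hgv, hgv]
        omega
      rw [if_neg hgu, if_neg hgv]
      have eg := hrow g
      have hg3 : δ g ≠ 3 := by simp [hf3, hgu, hgv]
      have : δ g = 0 ∨ δ g = 1 ∨ δ g = 2 ∨ δ g = 4 := by have := hδ4 g; omega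
      rcases this with e | e | e | e
      · rw [e] at eg
        simp only [coxeterCount] at eg
        omega
      · rw [e] at eg
        simp only [coxeterCount] at eg
        omega
      · rw [(h2 g).1 e, htu, htv]
        rfl
      · rw [hall g e, sub_self, sub_self]
    · right
      push Not at hall
      obtain ⟨w, dw, hw⟩ := hall
      have ew := hrow w
      rw [dw] at ew
      simp only [coxeterCount] at ew
      rcases Nat.lt_or_ge (S.interNum w s u) (S.interNum w s v) with hlt | hlt
      · have := S.mul_mul_eq_of_split (u := v) (v := u) (w := w) hs hδ4 h0 h1 h2
          (fun g => by rw [hf3, or_comm]) hvu hsum hkv hku htv htu (by omega) (by omega) (by omega)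
          (by omega) dw (by omega) (by omega)
        rw [← neg_sub, mul_neg, mul_neg, this, smul_neg]
      · exact S.mul_mul_eq_of_split hs hδ4 h0 h1 h2 hf3 hvu.symm hsum hku hkv htu htv (by omega)
          (by omega) (by omega) (by omega) dw (by omega) (by omega)

end AssociationScheme

theorem mainTheorem11 {X : Type*} [Finite X] {d : ℕ} (S : AssociationScheme X d)
    (s : Fin (d + 1)) (hs : s ≠ 0) :
    ¬ S.HasDiagram s coxeterFissionLoop ∧
    ¬ S.HasDiagram s coxeterFissionCross ∧
    ¬ S.HasDiagram s coxeterFissionLoop.bipartiteDouble ∧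
    ¬ S.HasDiagram s coxeterFissionCross.bipartiteDouble ∧
    (IsCoxeterGraph (S.schemeGraph s hs) →
      ∃ i, S.rel i = {p | (S.schemeGraph s hs).dist p.1 p.2 = 3}) := by
  cases nonempty_fintype X
  exact ⟨S.not_hasDiagram_loop s, S.not_hasDiagram_cross s,
    S.not_hasDiagram_loop_bipartiteDouble s, S.not_hasDiagram_cross_bipartiteDouble s,
    S.exists_rel_eq_of_isCoxeterGraph s hs⟩
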